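/- **Language.** Let $\mathcal L_Q$ be the first-order language with connectives $\bot,\sim,\land,\lor,\to$, quantifiers $\forall,\exists$, countably infinitely many constants $\mathsf{Con}$, countably infinitely many variables, and for each $n\in\mathbb N$ countably infinitely many $n$-ary predicate symbols $P^n_i$; terms are constants and variables. Put $\neg A:=A\to\bot$ and $A\leftrightarrow B:=(A\to B)\land(B\to A)$. $\mathsf{Sent}_Q$ is the set of formulas without free variables. **Proof system.** $\Gamma\vdash_i A$ means that $A$ is the last entry of a finite list of formulas, each of which is in $\Gamma$, is an instance of an axiom below, or follows from earlier entries by modus ponens (from $A$ and $A\to B$ infer $B$) or generalization (from $A$ infer $\forall xA$). Axioms: - $A\to(B\to A)$; $(A\to(B\to C))\to((A\to B)\to(A\to C))$; $(A\land B)\to A$; $(A\land B)\to B$; $(C\to A)\to((C\to B)\to(C\to(A\land B)))$; $A\to(A\lor B)$; $B\to(A\lor B)$; $(A\to C)\to((B\to C)\to((A\lor B)\to C))$; $\bot\to A$; - $A(t)\to\exists xA$ and $\forall xA\to A(t)$, where $t$ is free for $x$ in $A$; $\forall x(A\to B)\to(\exists yA(y)\to B)$, where $x$ is not free in $B$, $y$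 is free for $x$ in $A$, and $y=x$ or $y$ is not free in $A$; $\forall x(B\to A)\to(B\to\forall xA)$, where $x$ is not free in $B$; - $A\to{\sim}\bot$; ${\sim}{\sim}A\leftrightarrow A$; ${\sim}(A\land B)\leftrightarrow({\sim}A\lor{\sim}B)$; ${\sim}(A\lor B)\leftrightarrow({\sim}A\land{\sim}B)$; ${\sim}(A\to B)\leftrightarrow(\neg{\sim}A\land{\sim}B)$; ${\sim}\forall xA\leftrightarrow\exists x{\sim}A$; ${\sim}\exists xA\leftrightarrow\forall x{\sim}A$. **Models.** A QBDi-model $\langle W,\le,D,V\rangle$ consists of a non-empty set $W$, a partial order $\le$ on $W$, sets $D(w)\supseteq\mathsf{Con}$ for $w\in W$ with $D(w)\subseteq D(x)$ whenever $w\le x$, and, for each $w\in W$ and each $n$-ary predicate symbol $P$, an extension $V^+(w,P)\subseteq D(w)^n$ and an anti-extension $V^-(w,P)\subseteq D(w)^n$ such that $w\le x$ implies $V^+(w,P)\subseteq V^+(x,P)$ and $V^-(w,P)\subseteq V^-(x,P)$; no further relation between $V^+$ and $V^-$ is required. For sentences with parameters from $\bigcup_{w}D(w)$ the interpretation $I(w,A)\subseteq\{0,1\}$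 is given by: - $1\in I(w,P(\vec d))$ iff $\vec d\in V^+(w,P)$; $0\in I(w,P(\vec d))$ iff $\vec d\in V^-(w,P)$; - $1\notin I(w,\bot)$ and $0\in I(w,\bot)$; $1\in I(w,{\sim}A)$ iff $0\in I(w,A)$; $0\in I(w,{\sim}A)$ iff $1\in I(w,A)$; - $1\in I(w,A\land B)$ iff $1\in I(w,A)$ and $1\in I(w,B)$; $0\in I(w,A\land B)$ iff $0\in I(w,A)$ or $0\in I(w,B)$; - $1\in I(w,A\lor B)$ iff $1\in I(w,A)$ or $1\in I(w,B)$; $0\in I(w,A\lor B)$ iff $0\in I(w,A)$ and $0\in I(w,B)$; - $1\in I(w,A\to B)$ iff for all $x\ge w$: $1\notin I(x,A)$ or $1\in I(x,B)$; $0\in I(w,A\to B)$ iff $0\notin I(x,A)$ for all $x\ge w$, and $0\in I(w,B)$; - $1\in I(w,\forall xA)$ iff for all $y\ge w$ and all $d\in D(y)$, $1\in I(y,A(d))$; $0\in I(w,\forall xA)$ iff $0\in I(w,A(d))$ for some $d\in D(w)$; - $1\in I(w,\exists xA)$ iff $1\in I(w,A(d))$ for some $d\in D(w)$; $0\in I(w,\exists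 xA)$ iff for all $y\ge w$ and all $d\in D(y)$, $0\in I(y,A(d))$. $\Gamma\models_i A$ means that for every QBDi-model and every $w\in W$: if $1\in I(w,B)$ for all $B\in\Gamma$, then $1\in I(w,A)$. **Theorem (soundness and strong completeness of QBDi).** For all $\Gamma\cup\{A\}\subseteq\mathsf{Sent}_Q$: $\Gamma\vdash_i A$ if and only if $\Gamma\models_i A$. -/

import Mathlib

universe u v

namespace QBDi

/-! Syntax. Constants `c_i`, variables `v_i` and `n`-ary predicate symbols `P^n_i` are
indexed by natural numbers. -/

/-- A term is a constant or a variable. -/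
inductive Term : Type
  | const (c : ℕ) : Term
  | var (v : ℕ) : Term

/-- Formulas over `⊥, ∼, ∧, ∨, →, ∀, ∃`. `atom n i t` is `P^n_i(t_1, …, t_n)` and `tilde A`
is the strong negation `∼A`. -/
inductive Formula : Type
  | atom (n i : ℕ) (t : Fin n → Term) : Formula
  | bot : Formula
  | tilde (A : Formula) : Formula
  | and (A B : Formula) : Formula
  | or (A B : Formula) : Formula
  | imp (A B : Formula) : Formula
  | all (x : ℕ) (A : Formula) : Formula
  | ex (x : ℕ) (A : Formula) : Formula

/-- The variables of a term. -/
def Term.vars : Term → Finset ℕ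
  | .const _ => ∅
  | .var v => {v}

/-- `Term.subst x t s` replaces the variable `x` by `t` in the term `s`. -/
def Term.subst (x : ℕ) (t : Term) : Term → Term
  | .const c => .const c
  | .var v => if v = x then t else .var v

namespace Formula

/-- Intuitionistic negation `¬A := A → ⊥`. -/
def neg (A : Formula) : Formula := A.imp bot

/-- `A ↔ B := (A → B) ∧ (B → A)`. -/
def iff (A B : Formula) : Formula := (A.imp B).and (B.imp A)

/-- The free variables of a formula. -/
def freeVars : Formula → Finset ℕ
  | atom _ _ t => Finset.univ.biUnion fun k => (t k).vars
  | bot => ∅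
  | tilde A => A.freeVars
  | and A B => A.freeVars ∪ B.freeVars
  | or A B => A.freeVars ∪ B.freeVars
  | imp A B => A.freeVars ∪ B.freeVars
  | all x A => A.freeVars.erase x
  | ex x A => A.freeVars.erase x

/-- A sentence is a formula without free variables. -/
def IsSentence (A : Formula) : Prop := A.freeVars = ∅

/-- `subst x t A` is `A(t)`: the free occurrences of `x` in `A` are replaced by `t`.
It is used only where `t` is free for `x` in `A`. -/
def subst (x : ℕ) (t : Term) : Formula → Formula
  | atom n i s => atom n i fun k => Term.subst x t (s k)
  | bot => bot
  | tilde A => tilde (A.subst x t)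
  | and A B => and (A.subst x t) (B.subst x t)
  | or A B => or (A.subst x t) (B.subst x t)
  | imp A B => imp (A.subst x t) (B.subst x t)
  | all y A => if y = x then all y A else all y (A.subst x t)
  | ex y A => if y = x then ex y A else ex y (A.subst x t)

/-- `FreeFor x t A`: the term `t` is free for `x` in `A`, i.e. no free occurrence of `x` in `A`
lies in the scope of a quantifier that binds a variable of `t`. -/
def FreeFor (x : ℕ) (t : Term) : Formula → Prop
  | atom _ _ _ => True
  | bot => True
  | tilde A => A.FreeFor x t
  | and A B => A.FreeFor x t ∧ B.FreeFor x t
  | or A B => A.FreeFor x t ∧ B.FreeFor x t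
  | imp A B => A.FreeFor x t ∧ B.FreeFor x t
  | all y A => x ∉ (all y A).freeVars ∨ (y ∉ t.vars ∧ A.FreeFor x t)
  | ex y A => x ∉ (ex y A).freeVars ∨ (y ∉ t.vars ∧ A.FreeFor x t)

end Formula

open Formula in
/-- The axioms of QBDi. -/
inductive Ax : Formula → Prop
  | k (A B : Formula) : Ax (A.imp (B.imp A))
  | s (A B C : Formula) :
      Ax ((A.imp (B.imp C)).imp ((A.imp B).imp (A.imp C)))
  | and_left (A B : Formula) : Ax ((A.and B).imp A)
  | and_right (A B : Formula) : Ax ((A.and B).imp B)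
  | and_intro (A B C : Formula) :
      Ax ((C.imp A).imp ((C.imp B).imp (C.imp (A.and B))))
  | or_left (A B : Formula) : Ax (A.imp (A.or B))
  | or_right (A B : Formula) : Ax (B.imp (A.or B))
  | or_elim (A B C : Formula) :
      Ax ((A.imp C).imp ((B.imp C).imp ((A.or B).imp C)))
  | bot_elim (A : Formula) : Ax (bot.imp A)
  | ex_intro (x : ℕ) (t : Term) (A : Formula) (h : A.FreeFor x t) :
      Ax ((A.subst x t).imp (ex x A))
  | ex_elim (x y : ℕ) (A B : Formula) (hB : x ∉ B.freeVars)
      (hy : y = x ∨ y ∉ A.freeVars) (h : A.FreeFor x (.var y)) :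
      Ax ((all x (A.imp B)).imp ((ex y (A.subst x (.var y))).imp B))
  | all_intro (x : ℕ) (A B : Formula) (hB : x ∉ B.freeVars) :
      Ax ((all x (B.imp A)).imp (B.imp (all x A)))
  | all_elim (x : ℕ) (t : Term) (A : Formula) (h : A.FreeFor x t) :
      Ax ((all x A).imp (A.subst x t))
  | tilde_bot (A : Formula) : Ax (A.imp (tilde bot))
  | tilde_tilde (A : Formula) : Ax ((tilde (tilde A)).iff A)
  | tilde_and (A B : Formula) :
      Ax ((tilde (A.and B)).iff ((tilde A).or (tilde B)))
  | tilde_or (A B : Formula) :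
      Ax ((tilde (A.or B)).iff ((tilde A).and (tilde B)))
  | tilde_imp (A B : Formula) :
      Ax ((tilde (A.imp B)).iff ((tilde A).neg.and (tilde B)))
  | tilde_all (x : ℕ) (A : Formula) :
      Ax ((tilde (all x A)).iff (ex x (tilde A)))
  | tilde_ex (x : ℕ) (A : Formula) :
      Ax ((tilde (ex x A)).iff (all x (tilde A)))

/-- `Provable Γ A` is `Γ ⊢_i A`: derivability from `Γ` and the axioms by modus ponens and
generalization. -/
inductive Provable (Γ : Set Formula) : Formula → Prop
  | hyp {A : Formula} (h : A ∈ Γ) : Provable Γ A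
  | ax {A : Formula} (h : Ax A) : Provable Γ A
  | mp {A B : Formula} (hA : Provable Γ A) (hAB : Provable Γ (A.imp B)) : Provable Γ B
  | gen {A : Formula} (x : ℕ) (hA : Provable Γ A) : Provable Γ (Formula.all x A)

/-- QBDi-models `⟨W, ≤, D, V⟩`. The domains `D w` are subsets of a common type `U`; the injection
`con` realizes the inclusion of the set of constants in every domain. `V true` gives the extensions
`V⁺(w, P^n_i)` and `V false` the anti-extensions `V⁻(w, P^n_i)`. -/
structure Model : Type (max (u + 1) (v + 1)) where
  W : Type u
  order : PartialOrder W
  nonempty : Nonempty W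
  U : Type v
  con : ℕ ↪ U
  D : W → Set U
  con_mem : ∀ w c, con c ∈ D w
  D_mono : ∀ w x, w ≤ x → D w ⊆ D x
  V : Bool → W → (n i : ℕ) → Set (Fin n → U)
  V_dom : ∀ b w n i, ∀ d ∈ V b w n i, ∀ k, d k ∈ D w
  V_mono : ∀ b w x n i, w ≤ x → V b w n i ⊆ V b x n i

attribute [instance] Model.order Model.nonempty

namespace Model

/-- The element denoted by a term under the assignment `ρ`; a constant denotes itself. -/
def val (M : Model.{u, v}) (ρ : ℕ → M.U) : Term → M.U
  | .const c => M.con c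
  | .var x => ρ x

/-- The interpretation. `M.I A true w ρ` is `1 ∈ I(w, A)` and `M.I A false w ρ` is `0 ∈ I(w, A)`,
where the free variables of `A` stand for the elements that `ρ` assigns to them. -/
def I (M : Model.{u, v}) : Formula → Bool → M.W → (ℕ → M.U) → Prop
  | .atom n i t, b, w, ρ => (fun k => M.val ρ (t k)) ∈ M.V b w n i
  | .bot, true, _, _ => False
  | .bot, false, _, _ => True
  | .tilde A, true, w, ρ => M.I A false w ρ
  | .tilde A, false, w, ρ => M.I A true w ρ
  | .and A B, true, w, ρ => M.I A true w ρ ∧ M.I B true w ρ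
  | .and A B, false, w, ρ => M.I A false w ρ ∨ M.I B false w ρ
  | .or A B, true, w, ρ => M.I A true w ρ ∨ M.I B true w ρ
  | .or A B, false, w, ρ => M.I A false w ρ ∧ M.I B false w ρ
  | .imp A B, true, w, ρ => ∀ x, w ≤ x → (¬ M.I A true x ρ ∨ M.I B true x ρ)
  | .imp A B, false, w, ρ => (∀ x, w ≤ x → ¬ M.I A false x ρ) ∧ M.I B false w ρ
  | .all y A, true, w, ρ => ∀ x, w ≤ x → ∀ d ∈ M.D x, M.I A true x (Function.update ρ y d)
  | .all y A, false, w, ρ => ∃ d ∈ M.D w, M.I A false w (Function.update ρ y d)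
  | .ex y A, true, w, ρ => ∃ d ∈ M.D w, M.I A true w (Function.update ρ y d)
  | .ex y A, false, w, ρ => ∀ x, w ≤ x → ∀ d ∈ M.D x, M.I A false x (Function.update ρ y d)

theorem val_congr (M : Model.{u, v}) (t : Term) (ρ σ : ℕ → M.U)
    (h : ∀ x ∈ t.vars, ρ x = σ x) : M.val ρ t = M.val σ t := by
  cases t with
  | const c => rfl
  | var x => exact h x (by simp [Term.vars])

/-- The interpretation depends only on the values of the free variables. -/
theorem I_congr (M : Model.{u, v}) (A : Formula) : ∀ (b : Bool) (w : M.W) (ρ σ : ℕ → M.U),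
    (∀ x ∈ A.freeVars, ρ x = σ x) → (M.I A b w ρ ↔ M.I A b w σ) := by
  have upd : ∀ (y : ℕ) (s : Finset ℕ) (ρ σ : ℕ → M.U) (d : M.U),
      (∀ x ∈ s.erase y, ρ x = σ x) →
      ∀ x ∈ s, Function.update ρ y d x = Function.update σ y d x := by
    intro y s ρ σ d h x hx
    by_cases hxy : x = y
    · subst hxy; simp
    · simp [Function.update_of_ne hxy, h x (Finset.mem_erase.2 ⟨hxy, hx⟩)]
  induction A with
  | atom n i t =>
    intro b w ρ σ h
    have : (fun k => M.val ρ (t k)) = fun k => M.val σ (t k) := by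
      funext k
      exact M.val_congr _ _ _ fun x hx => h x (by
        simp only [Formula.freeVars, Finset.mem_biUnion]
        exact ⟨k, Finset.mem_univ _, hx⟩)
    simp only [I, this]
  | bot => intro b w ρ σ _; cases b <;> simp [I]
  | tilde A ih => intro b w ρ σ h; cases b <;> simp only [I] <;> exact ih _ _ _ _ h
  | and A B ihA ihB | or A B ihA ihB | imp A B ihA ihB =>
    intro b w ρ σ h
    simp only [Formula.freeVars, Finset.mem_union] at h
    have hA := fun b w => ihA b w ρ σ fun x hx => h x (Or.inl hx)
    have hB := fun b w => ihB b w ρ σ fun x hx => h x (Or.inr hx)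
    cases b <;> simp only [I, hA, hB]
  | all y A ih | ex y A ih =>
    intro b w ρ σ h
    have hA := fun b w d => ih b w _ _ (upd y A.freeVars ρ σ d h)
    cases b <;> simp only [I, hA]

/-- The interpretation of a sentence does not depend on the assignment. -/
theorem I_sentence (M : Model.{u, v}) {A : Formula} (hA : A.IsSentence) (b : Bool) (w : M.W)
    (ρ σ : ℕ → M.U) : M.I A b w ρ ↔ M.I A b w σ :=
  M.I_congr A b w ρ σ (by rw [hA]; simp)

end Model

/-- `Entails Γ A` is `Γ ⊨_i A` for sentences. The assignment `ρ` into the domain of `w` is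
immaterial for sentences (`Model.I_sentence`). -/
def Entails (Γ : Set Formula) (A : Formula) : Prop :=
  ∀ (M : Model.{u, v}) (w : M.W) (ρ : ℕ → M.U), (∀ x, ρ x ∈ M.D w) →
    (∀ B ∈ Γ, M.I B true w ρ) → M.I A true w ρ

end QBDi

/-! Soundness is an induction on derivations. Completeness is a Henkin argument with a canonical
Kripke model of growing domains.

The constants are split into countably many levels, each infinite, by decoding a constant as a pair.
The constants of the given sentences are first renamed injectively into level 0, which leaves all
higher levels unused; `provable_of_mapConst_levelZero` undoes the renaming. If `Γ` does not prove
`A` at level `k`, the constants of level `k + 1` serve as Henkin witnesses, and a Lindenbaum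
construction (`exists_saturated`) gives a consistent prime theory with witnesses that contains `Γ`
and omits `A`.

The worlds are pairs of a level and a saturated theory of that level, ordered by inclusion, and the
domain of a world consists of the constants up to its level. Fresh constants are always available
one level higher, so a world omitting `A → B` or `∀ x, A` has an extension that refutes it
(`World.imp_mem`, `World.all_mem`), and no constant domain axiom is needed.

Strong negation requires no further construction. Extensions and anti-extensions are independent, so
`0 ∈ I(w, A)` can be matched with `∼A ∈ w`, and each axiom for `∼` is the falsity clause of one
connective. `truth_lemma` proves both matches at once. The world obtained from an unprovable
sentence is then a countermodel. -/

namespace QBDi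

/-! ### Syntax: simultaneous replacement of constants and variables -/

/-- Replace every constant `c` by `γ c` and every variable `v` by `σ v`. -/
def Term.bind (γ σ : ℕ → Term) : Term → Term
  | .const c => γ c
  | .var v => σ v

/-- The constants of a term. -/
def Term.consts : Term → Finset ℕ
  | .const c => {c}
  | .var _ => ∅

namespace Formula

/-- Replace every constant `c` by `γ c` and every free variable `v` by `σ v`. -/
def bind (γ : ℕ → Term) : (ℕ → Term) → Formula → Formula
  | σ, atom n i t => atom n i fun k => (t k).bind γ σ
  | _, bot => bot
  | σ, tilde A => tilde (A.bind γ σ)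
  | σ, and A B => and (A.bind γ σ) (B.bind γ σ)
  | σ, or A B => or (A.bind γ σ) (B.bind γ σ)
  | σ, imp A B => imp (A.bind γ σ) (B.bind γ σ)
  | σ, all y A => all y (A.bind γ (Function.update σ y (.var y)))
  | σ, ex y A => ex y (A.bind γ (Function.update σ y (.var y)))

/-- Replace every constant `c` by the term `γ c`. -/
abbrev mapConst (γ : ℕ → Term) (A : Formula) : Formula := A.bind γ Term.var

/-- The constants of a formula. -/
def consts : Formula → Finset ℕ
  | atom _ _ t => Finset.univ.biUnion fun k => (t k).consts
  | bot => ∅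
  | tilde A => A.consts
  | and A B => A.consts ∪ B.consts
  | or A B => A.consts ∪ B.consts
  | imp A B => A.consts ∪ B.consts
  | all _ A => A.consts
  | ex _ A => A.consts

/-- The variables of a formula, free or bound. -/
def allVars : Formula → Finset ℕ
  | atom _ _ t => Finset.univ.biUnion fun k => (t k).vars
  | bot => ∅
  | tilde A => A.allVars
  | and A B => A.allVars ∪ B.allVars
  | or A B => A.allVars ∪ B.allVars
  | imp A B => A.allVars ∪ B.allVars
  | all x A => insert x A.allVars
  | ex x A => insert x A.allVars

theorem update_var (y : ℕ) : Function.update Term.var y (.var y) = Term.var :=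
  Function.update_eq_self y Term.var

theorem mapConst_all (γ : ℕ → Term) (y : ℕ) (A : Formula) :
    (all y A).mapConst γ = all y (A.mapConst γ) := by
  simp only [mapConst, bind, update_var]

theorem mapConst_ex (γ : ℕ → Term) (y : ℕ) (A : Formula) :
    (ex y A).mapConst γ = ex y (A.mapConst γ) := by
  simp only [mapConst, bind, update_var]

theorem freeVars_subset_allVars (A : Formula) : A.freeVars ⊆ A.allVars := by
  induction A with
  | atom | bot => simp [freeVars, allVars]
  | tilde A ih => simpa [freeVars, allVars] using ih
  | and A B ihA ihB | or A B ihA ihB | imp A B ihA ihB =>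
    exact Finset.union_subset_union ihA ihB
  | all y A ih | ex y A ih =>
    exact ((Finset.erase_subset _ _).trans ih).trans (Finset.subset_insert _ _)

/-! ### Substitution for one variable, and avoidance of capture. -/

theorem subst_of_notMem {x : ℕ} {t : Term} {A : Formula} (h : x ∉ A.freeVars) :
    A.subst x t = A := by
  induction A with
  | atom n i s =>
    simp only [freeVars, Finset.mem_biUnion, Finset.mem_univ, true_and, not_exists] at h
    simp only [subst, atom.injEq, heq_eq_eq, true_and]
    funext k
    specialize h k
    cases hk : s k with
    | const c => rfl
    | var v =>
      rw [hk] at h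
      have : v ≠ x := fun e => h (by simp [Term.vars, e])
      simp [Term.subst, this]
  | bot => rfl
  | tilde A ih => simp only [subst, ih h]
  | and A B ihA ihB | or A B ihA ihB | imp A B ihA ihB =>
    simp only [freeVars, Finset.mem_union, not_or] at h
    simp only [subst, ihA h.1, ihB h.2]
  | all y A ih | ex y A ih =>
    by_cases hy : y = x
    · simp [subst, hy]
    · have : x ∉ A.freeVars := fun hx => h (Finset.mem_erase.2 ⟨Ne.symm hy, hx⟩)
      simp [subst, hy, ih this]

theorem subst_self (x : ℕ) (A : Formula) : A.subst x (.var x) = A := by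
  induction A with
  | atom n i s =>
    simp only [subst, atom.injEq, heq_eq_eq, true_and]
    funext k
    cases s k with
    | const c => rfl
    | var v => by_cases hv : v = x <;> simp [Term.subst, hv]
  | bot => rfl
  | tilde A ih => simp only [subst, ih]
  | and A B ihA ihB | or A B ihA ihB | imp A B ihA ihB => simp only [subst, ihA, ihB]
  | all y A ih | ex y A ih => by_cases hy : y = x <;> simp [subst, hy, ih]

theorem freeFor_self (x : ℕ) (A : Formula) : A.FreeFor x (.var x) := by
  induction A with
  | atom | bot => trivial
  | tilde A ih => exact ih
  | and A B ihA ihB | or A B ihA ihB | imp A B ihA ihB => exact ⟨ihA, ihB⟩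
  | all y A ih | ex y A ih =>
    by_cases hy : y = x
    · left; simp [freeVars, hy]
    · right; exact ⟨by simpa [Term.vars] using hy, ih⟩

theorem freeFor_const (x c : ℕ) (A : Formula) : A.FreeFor x (.const c) := by
  induction A with
  | atom | bot => trivial
  | tilde A ih => exact ih
  | and A B ihA ihB | or A B ihA ihB | imp A B ihA ihB => exact ⟨ihA, ihB⟩
  | all y A ih | ex y A ih => exact Or.inr ⟨by simp [Term.vars], ih⟩

theorem freeFor_of_notMem {x : ℕ} (t : Term) {A : Formula} (h : x ∉ A.freeVars) :
    A.FreeFor x t := by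
  induction A with
  | atom | bot => trivial
  | tilde A ih => exact ih h
  | and A B ihA ihB | or A B ihA ihB | imp A B ihA ihB =>
    simp only [freeVars, Finset.mem_union, not_or] at h
    exact ⟨ihA h.1, ihB h.2⟩
  | all y A ih | ex y A ih => exact Or.inl h

/-- Together with `freeFor_subst_fresh` this lets a generalization over a fresh variable be turned
back into one over `x`. Bound occurrences of `z` must be excluded too, since they would capture. -/
theorem subst_subst_fresh {x z : ℕ} {A : Formula} (h : z ∉ A.allVars) :
    (A.subst x (.var z)).subst z (.var x) = A := by
  induction A with
  | atom n i s =>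
    simp only [allVars, Finset.mem_biUnion, Finset.mem_univ, true_and, not_exists] at h
    simp only [subst, atom.injEq, heq_eq_eq, true_and]
    funext k
    specialize h k
    cases hk : s k with
    | const c => rfl
    | var v =>
      rw [hk] at h
      have : v ≠ z := fun e => h (by simp [Term.vars, e])
      by_cases hv : v = x <;> simp [Term.subst, this, hv]
  | bot => rfl
  | tilde A ih => simp only [subst, ih h]
  | and A B ihA ihB | or A B ihA ihB | imp A B ihA ihB =>
    simp only [allVars, Finset.mem_union, not_or] at h
    simp only [subst, ihA h.1, ihB h.2]
  | all y A ih | ex y A ih =>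
    simp only [allVars, Finset.mem_insert, not_or] at h
    by_cases hy : y = x
    · have := subst_of_notMem (t := .var x) fun hz => h.2 (freeVars_subset_allVars A hz)
      simp [subst, hy, this]
    · simp [subst, hy, Ne.symm h.1, ih h.2]

theorem freeFor_subst_fresh {x z : ℕ} {A : Formula} (h : z ∉ A.allVars) :
    (A.subst x (.var z)).FreeFor z (.var x) := by
  induction A with
  | atom | bot => trivial
  | tilde A ih => exact ih h
  | and A B ihA ihB | or A B ihA ihB | imp A B ihA ihB =>
    simp only [allVars, Finset.mem_union, not_or] at h
    exact ⟨ihA h.1, ihB h.2⟩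
  | all y A ih | ex y A ih =>
    by_cases hy : y = x
    · simp only [subst, hy, if_true]
      exact freeFor_of_notMem _ fun hz => h (by
        rw [hy]; exact freeVars_subset_allVars _ hz)
    · simp only [allVars, Finset.mem_insert, not_or] at h
      simp only [subst, hy, if_false]
      exact Or.inr ⟨by simpa [Term.vars] using hy, ih h.2⟩

theorem mem_freeVars_subst {x v : ℕ} {t : Term} {A : Formula} (h : v ∈ (A.subst x t).freeVars) :
    (v ∈ A.freeVars ∧ v ≠ x) ∨ v ∈ t.vars := by
  induction A with
  | atom n i s =>
    simp only [subst, freeVars, Finset.mem_biUnion, Finset.mem_univ, true_and] at h ⊢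
    obtain ⟨k, hk⟩ := h
    cases hs : s k with
    | const c => simp [hs, Term.subst, Term.vars] at hk
    | var u =>
      by_cases hu : u = x
      · right; simpa [hs, Term.subst, hu] using hk
      · left
        rw [hs] at hk
        simp only [Term.subst, hu, if_false] at hk
        refine ⟨⟨k, by rwa [hs]⟩, ?_⟩
        simp only [Term.vars, Finset.mem_singleton] at hk
        rwa [hk]
  | bot => simp [subst, freeVars] at h
  | tilde A ih => exact ih h
  | and A B ihA ihB | or A B ihA ihB | imp A B ihA ihB =>
    simp only [subst, freeVars, Finset.mem_union] at h ⊢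
    rcases h with h | h
    · have := ihA h; tauto
    · have := ihB h; tauto
  | all y A ih | ex y A ih =>
    by_cases hy : y = x
    · simp only [subst, hy, if_true] at h
      left; rw [hy]
      exact ⟨h, (Finset.mem_erase.1 h).1⟩
    · simp only [subst, hy, if_false, freeVars, Finset.mem_erase] at h ⊢
      have := ih h.2; tauto

theorem mem_consts_subst {x c : ℕ} {t : Term} {A : Formula} (h : c ∈ (A.subst x t).consts) :
    c ∈ A.consts ∨ c ∈ t.consts := by
  induction A with
  | atom n i s =>
    simp only [subst, consts, Finset.mem_biUnion, Finset.mem_univ, true_and] at h ⊢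
    obtain ⟨k, hk⟩ := h
    cases hs : s k with
    | const d => exact Or.inl ⟨k, by simpa [hs, Term.subst] using hk⟩
    | var u =>
      by_cases hu : u = x
      · right; simpa [hs, Term.subst, hu] using hk
      · simp [hs, Term.subst, hu, Term.consts] at hk
  | bot => simp [subst, consts] at h
  | tilde A ih => exact ih h
  | and A B ihA ihB | or A B ihA ihB | imp A B ihA ihB =>
    simp only [subst, consts, Finset.mem_union] at h ⊢
    rcases h with h | h
    · have := ihA h; tauto
    · have := ihB h; tauto
  | all y A ih | ex y A ih =>
    by_cases hy : y = x
    · simp only [subst, hy, if_true] at h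
      exact Or.inl h
    · simp only [subst, hy, if_false] at h
      exact ih h

/-! ### Simultaneous replacement. -/

theorem mem_consts_bind {P : ℕ → Prop} {γ : ℕ → Term} (hγ : ∀ c, ∀ d ∈ (γ c).consts, P d)
    (A : Formula) : ∀ σ : ℕ → Term, (∀ v, ∀ d ∈ (σ v).consts, P d) →
      ∀ d ∈ (A.bind γ σ).consts, P d := by
  induction A with
  | atom n i t =>
    intro σ hσ d hd
    simp only [bind, consts, Finset.mem_biUnion, Finset.mem_univ, true_and] at hd
    obtain ⟨k, hk⟩ := hd
    cases ht : t k with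
    | const c => exact hγ c d (by simpa [ht, Term.bind] using hk)
    | var v => exact hσ v d (by simpa [ht, Term.bind] using hk)
  | bot => intro σ _ d hd; simp [bind, consts] at hd
  | tilde A ih => exact ih
  | and A B ihA ihB | or A B ihA ihB | imp A B ihA ihB =>
    intro σ hσ d hd
    rcases Finset.mem_union.1 hd with h | h
    exacts [ihA σ hσ d h, ihB σ hσ d h]
  | all y A ih | ex y A ih =>
    intro σ hσ d hd
    refine ih _ (fun v e he => ?_) d hd
    by_cases hv : v = y
    · subst hv; simp [Term.consts] at he
    · rw [Function.update_of_ne hv] at he; exact hσ v e he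

theorem bind_congr {γ : ℕ → Term} {A : Formula} : ∀ {σ τ : ℕ → Term},
    (∀ v ∈ A.freeVars, σ v = τ v) → A.bind γ σ = A.bind γ τ := by
  induction A with
  | atom n i t =>
    intro σ τ h
    simp only [bind, atom.injEq, heq_eq_eq, true_and]
    funext k
    cases ht : t k with
    | const c => rfl
    | var v => exact h v (Finset.mem_biUnion.2 ⟨k, Finset.mem_univ _, by simp [ht, Term.vars]⟩)
  | bot => intros; rfl
  | tilde A ih => intro σ τ h; simp only [bind]; rw [ih h]
  | and A B ihA ihB | or A B ihA ihB | imp A B ihA ihB =>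
    intro σ τ h
    simp only [bind]
    rw [ihA fun v hv => h v (Finset.mem_union_left _ hv),
      ihB fun v hv => h v (Finset.mem_union_right _ hv)]
  | all y A ih | ex y A ih =>
    intro σ τ h
    simp only [bind]
    rw [ih fun v hv => ?_]
    by_cases e : v = y
    · subst e; simp
    · simpa [Function.update_of_ne e] using h v (Finset.mem_erase.2 ⟨e, hv⟩)

theorem mem_freeVars_bind {γ : ℕ → Term} (hγ : ∀ c, (γ c).vars = ∅) {v : ℕ} (A : Formula) :
    ∀ σ : ℕ → Term, (∀ u, σ u = .var u ∨ (σ u).vars = ∅) → v ∈ (A.bind γ σ).freeVars →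
      v ∈ A.freeVars ∧ σ v = .var v := by
  induction A with
  | atom n i t =>
    intro σ hσ h
    simp only [bind, freeVars, Finset.mem_biUnion, Finset.mem_univ, true_and] at h ⊢
    obtain ⟨k, hk⟩ := h
    cases ht : t k with
    | const c => simp [ht, Term.bind, hγ] at hk
    | var u =>
      simp only [ht, Term.bind] at hk
      rcases hσ u with hu | hu
      · rw [hu] at hk
        simp only [Term.vars, Finset.mem_singleton] at hk
        subst hk
        exact ⟨⟨k, by simp [ht, Term.vars]⟩, hu⟩
      · simp [hu] at hk
  | bot => intro σ _ h; simp [bind, freeVars] at h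
  | tilde A ih => exact ih
  | and A B ihA ihB | or A B ihA ihB | imp A B ihA ihB =>
    intro σ hσ h
    simp only [bind, freeVars, Finset.mem_union] at h ⊢
    rcases h with h | h
    · have := ihA σ hσ h; tauto
    · have := ihB σ hσ h; tauto
  | all y A ih | ex y A ih =>
    intro σ hσ h
    simp only [bind, freeVars, Finset.mem_erase] at h ⊢
    have := ih _ (fun u => ?_) h.2
    · rw [Function.update_of_ne h.1] at this; tauto
    · by_cases e : u = y
      · subst e; simp
      · simpa [Function.update_of_ne e] using hσ u

/-- The restriction on `σ` ensures that below a binder of `y` no other variable has been sent to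
`y`, so that skipping the substitution there loses nothing. The restriction on `γ` keeps replaced
constants out of its reach. -/
theorem subst_bind {γ : ℕ → Term} (hγ : ∀ c, ∃ d, γ c = .const d) (y : ℕ) (t : Term)
    (A : Formula) : ∀ σ : ℕ → Term, (∀ v, σ v = .var v ∨ ∃ d, σ v = .const d) →
      (A.bind γ σ).subst y t = A.bind γ fun v => Term.subst y t (σ v) := by
  induction A with
  | atom n i s =>
    intro σ _
    simp only [bind, subst, atom.injEq, heq_eq_eq, true_and]
    funext k
    cases s k with
    | const c => obtain ⟨d, hd⟩ := hγ c; simp [Term.bind, hd, Term.subst]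
    | var v => rfl
  | bot => intros; rfl
  | tilde A ih => intro σ hσ; simp only [bind, subst, ih σ hσ]
  | and A B ihA ihB | or A B ihA ihB | imp A B ihA ihB =>
    intro σ hσ; simp only [bind, subst, ihA σ hσ, ihB σ hσ]
  | all z A ih | ex z A ih =>
    intro σ hσ
    simp only [bind, subst]
    split_ifs with hz
    · congr 2
      funext v
      by_cases e : v = z
      · subst e; simp
      · rw [Function.update_of_ne e, Function.update_of_ne e]
        rcases hσ v with h | ⟨d, h⟩
        · simp [h, Term.subst, ← hz, e]
        · simp [h, Term.subst]
    · rw [ih]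
      · congr 2
        funext v
        by_cases e : v = z
        · subst e; simp [Term.subst, hz]
        · simp [Function.update_of_ne e]
      · intro v
        by_cases e : v = z
        · subst e; simp
        · simpa [Function.update_of_ne e] using hσ v

/-- If some `γ c` contained `x`, the substitution on the right would also hit the occurrences that
`γ` creates. -/
theorem mapConst_subst {γ : ℕ → Term} {x : ℕ} (hγ : ∀ c, x ∉ (γ c).vars) (t : Term)
    (A : Formula) : (A.subst x t).mapConst γ = (A.mapConst γ).subst x (t.bind γ .var) := by
  induction A with
  | atom n i s =>
    simp only [mapConst, bind, subst, atom.injEq, heq_eq_eq, true_and]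
    funext k
    cases s k with
    | const c =>
      simp only [Term.subst, Term.bind]
      have := hγ c
      cases hc : γ c with
      | const d => rfl
      | var v =>
        have : v ≠ x := fun e => this (by simp [hc, Term.vars, e])
        simp [this]
    | var v => by_cases hv : v = x <;> simp [Term.subst, Term.bind, hv]
  | bot => rfl
  | tilde A ih => simpa only [mapConst, bind, subst, tilde.injEq] using ih
  | and A B ihA ihB | or A B ihA ihB | imp A B ihA ihB =>
    simp only [mapConst] at ihA ihB
    simp only [mapConst, bind, subst, ihA, ihB]
  | all y A ih | ex y A ih =>
    simp only [mapConst] at ih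
    by_cases hy : y = x <;> simp [mapConst, bind, subst, hy, ih]

theorem mem_freeVars_mapConst {γ : ℕ → Term} {x : ℕ} (hγ : ∀ c, x ∉ (γ c).vars) {A : Formula} :
    x ∈ (A.mapConst γ).freeVars → x ∈ A.freeVars := by
  induction A with
  | atom n i s =>
    simp only [mapConst, bind, freeVars, Finset.mem_biUnion, Finset.mem_univ, true_and]
    rintro ⟨k, hk⟩
    refine ⟨k, ?_⟩
    cases hs : s k with
    | const c => rw [hs] at hk; exact absurd hk (hγ c)
    | var v => rwa [hs] at hk
  | bot => simp [bind]
  | tilde A ih => exact ih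
  | and A B ihA ihB | or A B ihA ihB | imp A B ihA ihB =>
    simp only [mapConst] at ihA ihB
    simp only [mapConst, bind, freeVars, Finset.mem_union]
    tauto
  | all y A ih | ex y A ih =>
    simp only [mapConst] at ih
    simp only [mapConst, bind, update_var, freeVars, Finset.mem_erase]
    tauto

theorem FreeFor.mapConst {γ : ℕ → Term} {x : ℕ} {t : Term} {A : Formula} (h : A.FreeFor x t)
    (hx : ∀ c, x ∉ (γ c).vars) (hA : ∀ c, ∀ v ∈ A.allVars, v ∉ (γ c).vars) :
    (A.mapConst γ).FreeFor x (t.bind γ .var) := by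
  induction A with
  | atom | bot => trivial
  | tilde A ih => exact ih h hA
  | and A B ihA ihB | or A B ihA ihB | imp A B ihA ihB =>
    exact ⟨ihA h.1 fun c v hv => hA c v (Finset.mem_union_left _ hv),
      ihB h.2 fun c v hv => hA c v (Finset.mem_union_right _ hv)⟩
  | all y A ih | ex y A ih =>
    simp only [mapConst_all, mapConst_ex]
    rcases h with h | ⟨hy, h⟩
    · left
      intro hm
      simp only [freeVars, Finset.mem_erase] at h hm
      exact h ⟨hm.1, mem_freeVars_mapConst hx hm.2⟩
    · refine Or.inr ⟨?_, ih h fun c v hv => hA c v (Finset.mem_insert_of_mem hv)⟩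
      cases t with
      | const c => exact hA c y (Finset.mem_insert_self _ _)
      | var v => exact hy

theorem mapConst_eq_self {γ : ℕ → Term} {A : Formula} (h : ∀ c ∈ A.consts, γ c = .const c) :
    A.mapConst γ = A := by
  induction A with
  | atom n i s =>
    simp only [mapConst, bind, atom.injEq, heq_eq_eq, true_and]
    funext k
    cases hs : s k with
    | const c => exact h c (Finset.mem_biUnion.2 ⟨k, Finset.mem_univ _, by simp [hs, Term.consts]⟩)
    | var v => rfl
  | bot => rfl
  | tilde A ih => simpa only [mapConst, bind, tilde.injEq] using ih h
  | and A B ihA ihB | or A B ihA ihB | imp A B ihA ihB =>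
    simp only [mapConst] at ihA ihB
    simp only [mapConst, bind, ihA fun c hc => h c (Finset.mem_union_left _ hc),
      ihB fun c hc => h c (Finset.mem_union_right _ hc)]
  | all y A ih | ex y A ih =>
    simp only [mapConst] at ih
    simp only [mapConst, bind, update_var, ih h]

theorem mapConst_mapConst (γ : ℕ → Term) (f : ℕ → ℕ) (A : Formula) :
    (A.mapConst fun c => .const (f c)).mapConst γ = A.mapConst fun c => γ (f c) := by
  induction A with
  | atom n i s =>
    simp only [mapConst, bind, atom.injEq, heq_eq_eq, true_and]
    funext k
    cases s k <;> rfl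
  | bot => rfl
  | tilde A ih => simpa only [mapConst, bind, tilde.injEq] using ih
  | and A B ihA ihB | or A B ihA ihB | imp A B ihA ihB =>
    simp only [mapConst] at ihA ihB
    simp only [mapConst, bind, ihA, ihB]
  | all y A ih | ex y A ih =>
    simp only [mapConst] at ih
    simp only [mapConst, bind, update_var, ih]

/-- A numerical code of a term. -/
def _root_.QBDi.Term.code : Term → ℕ
  | .const c => 2 * c
  | .var v => 2 * v + 1

theorem _root_.QBDi.Term.code_injective : Function.Injective Term.code := by
  intro s t h
  cases s <;> cases t <;> simp only [Term.code] at h <;> grind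

/-- A numerical code of a formula. -/
def code : Formula → ℕ
  | atom n i t => Nat.pair 0 (Nat.pair i (Encodable.encode (List.ofFn fun k : Fin n => (t k).code)))
  | bot => Nat.pair 1 0
  | tilde A => Nat.pair 2 A.code
  | and A B => Nat.pair 3 (Nat.pair A.code B.code)
  | or A B => Nat.pair 4 (Nat.pair A.code B.code)
  | imp A B => Nat.pair 5 (Nat.pair A.code B.code)
  | all x A => Nat.pair 6 (Nat.pair x A.code)
  | ex x A => Nat.pair 7 (Nat.pair x A.code)

/-- This makes the formulas countable, so that the Lindenbaum construction can enumerate them. The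
arity of an atom is not stored: it is recovered as the length of the coded list. -/
theorem code_injective : Function.Injective code := by
  intro A
  induction A with
  | atom n i t =>
    intro B h
    cases B <;> simp only [code, Nat.pair_eq_pair, OfNat.zero_ne_ofNat,
      zero_ne_one, false_and, true_and] at h
    obtain ⟨rfl, h⟩ := h
    have h := Encodable.encode_injective h
    have hn := congrArg List.length h
    simp only [List.length_ofFn] at hn
    subst hn
    have := List.ofFn_injective h
    congr 1
    funext k
    exact Term.code_injective (congrFun this k)
  | bot => intro B h; cases B <;> simp [code] at h ⊢
  | tilde A ih =>
    intro B h; cases B <;> simp [code] at h ⊢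
    exact ih h
  | and A B ihA ihB | or A B ihA ihB | imp A B ihA ihB =>
    intro B h; cases B <;> simp [code] at h ⊢
    exact ⟨ihA h.1, ihB h.2⟩
  | all y A ih | ex y A ih =>
    intro B h; cases B <;> simp [code] at h ⊢
    exact ⟨h.1, ih h.2⟩

instance : Countable Formula := code_injective.countable

instance : Nonempty Formula := ⟨bot⟩

end Formula

/-! ### Soundness -/

namespace Model

variable (M : Model.{u, v})

theorem val_mem {w : M.W} {ρ : ℕ → M.U} (hρ : ∀ x, ρ x ∈ M.D w) (t : Term) :
    M.val ρ t ∈ M.D w := by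
  cases t with
  | const c => exact M.con_mem w c
  | var x => exact hρ x

theorem update_mem {w : M.W} {ρ : ℕ → M.U} (hρ : ∀ x, ρ x ∈ M.D w) (y : ℕ) {d : M.U}
    (hd : d ∈ M.D w) (x : ℕ) : Function.update ρ y d x ∈ M.D w := by
  by_cases h : x = y
  · subst h; simpa using hd
  · simpa [Function.update_of_ne h] using hρ x

/-- Truth and falsity persist along the order. -/
theorem I_mono (A : Formula) : ∀ (b : Bool) {w x : M.W} (ρ : ℕ → M.U), w ≤ x →
    M.I A b w ρ → M.I A b x ρ := by
  induction A with
  | atom n i t => intro b w x ρ h; exact fun hw => M.V_mono b w x n i h hw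
  | bot => intro b w x ρ h; cases b <;> exact id
  | tilde A ih => intro b w x ρ h; cases b <;> exact ih _ ρ h
  | and A B ihA ihB =>
    intro b w x ρ h
    cases b
    exacts [Or.imp (ihA _ ρ h) (ihB _ ρ h), And.imp (ihA _ ρ h) (ihB _ ρ h)]
  | or A B ihA ihB =>
    intro b w x ρ h
    cases b
    exacts [And.imp (ihA _ ρ h) (ihB _ ρ h), Or.imp (ihA _ ρ h) (ihB _ ρ h)]
  | imp A B ihA ihB =>
    intro b w x ρ h
    cases b
    · exact And.imp (fun hw y hy => hw y (h.trans hy)) (ihB _ ρ h)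
    · exact fun hw y hy => hw y (h.trans hy)
  | all y A ih =>
    intro b w x ρ h
    cases b
    · rintro ⟨d, hd, hA⟩; exact ⟨d, M.D_mono _ _ h hd, ih _ _ h hA⟩
    · exact fun hw z hz => hw z (h.trans hz)
  | ex y A ih =>
    intro b w x ρ h
    cases b
    · exact fun hw z hz => hw z (h.trans hz)
    · rintro ⟨d, hd, hA⟩; exact ⟨d, M.D_mono _ _ h hd, ih _ _ h hA⟩

theorem I_imp_true {A B : Formula} {w : M.W} {ρ : ℕ → M.U} :
    M.I (A.imp B) true w ρ ↔ ∀ x, w ≤ x → M.I A true x ρ → M.I B true x ρ := by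
  simp only [I, imp_iff_not_or]

theorem val_subst (ρ : ℕ → M.U) (x : ℕ) (t s : Term) :
    M.val ρ (Term.subst x t s) = M.val (Function.update ρ x (M.val ρ t)) s := by
  cases s with
  | const c => rfl
  | var v => by_cases h : v = x <;> simp [Term.subst, val, h]

/-- Below a binder that `t` avoids, the updates for `x` and for the bound variable commute and the
value of `t` is unchanged. -/
theorem I_subst {x : ℕ} {t : Term} {A : Formula} : A.FreeFor x t →
    ∀ (b : Bool) (w : M.W) (ρ : ℕ → M.U),
      M.I (A.subst x t) b w ρ ↔ M.I A b w (Function.update ρ x (M.val ρ t)) := by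
  induction A with
  | atom n i s => intro _ b w ρ; simp only [Formula.subst, I, val_subst]
  | bot => intro _ b w ρ; cases b <;> rfl
  | tilde A ih => intro h b w ρ; cases b <;> exact ih h _ w ρ
  | and A B ihA ihB | or A B ihA ihB | imp A B ihA ihB =>
    intro h b w ρ
    cases b <;> simp only [Formula.subst, I, ihA h.1, ihB h.2]
  | all y A ih | ex y A ih =>
    intro h b w ρ
    by_cases hf : x ∈ A.freeVars ∧ y ≠ x
    · obtain ⟨hx, hy⟩ := hf
      simp only [Formula.FreeFor, Formula.freeVars, Finset.mem_erase, hx, Ne.symm hy, ne_eq,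
        not_false_eq_true, and_self, not_true, false_or] at h
      have key : ∀ b z d, M.I (A.subst x t) b z (Function.update ρ y d) ↔
          M.I A b z (Function.update (Function.update ρ x (M.val ρ t)) y d) := by
        intro b z d
        rw [ih h.2, M.val_congr t (Function.update ρ y d) ρ fun v hv =>
          Function.update_of_ne (ne_of_mem_of_not_mem hv h.1) _ _, Function.update_comm (Ne.symm hy)]
      cases b <;> simp only [Formula.subst, hy, if_false, I, key]
    -- Here `x` is not free in the quantified formula, so neither the substitution nor the update
    -- has an effect.
    · have hy : x ∉ A.freeVars.erase y := by
        rw [Finset.mem_erase]; exact fun e => hf ⟨e.2, Ne.symm e.1⟩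
      rw [Formula.subst_of_notMem hy]
      refine M.I_congr _ b w _ _ fun v hv => ?_
      rw [Function.update_of_ne (ne_of_mem_of_not_mem hv hy)]

/-- Every axiom is true at every world. -/
theorem I_of_ax {A : Formula} (h : Ax A) (w : M.W) (ρ : ℕ → M.U) (hρ : ∀ x, ρ x ∈ M.D w) :
    M.I A true w ρ := by
  cases h with
  | k A B =>
    simp only [I_imp_true]
    exact fun x _ hA y hy _ => M.I_mono _ _ _ hy hA
  | s A B C =>
    simp only [I_imp_true]
    exact fun x _ h₁ y hy h₂ z hz hA => h₁ z (hy.trans hz) hA z le_rfl (h₂ z hz hA)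
  | and_left A B => simp only [I_imp_true]; exact fun x _ h => h.1
  | and_right A B => simp only [I_imp_true]; exact fun x _ h => h.2
  | and_intro A B C =>
    simp only [I_imp_true]
    exact fun x _ h₁ y hy h₂ z hz hC => ⟨h₁ z (hy.trans hz) hC, h₂ z hz hC⟩
  | or_left A B => simp only [I_imp_true]; exact fun x _ h => Or.inl h
  | or_right A B => simp only [I_imp_true]; exact fun x _ h => Or.inr h
  | or_elim A B C =>
    simp only [I_imp_true]
    exact fun x _ h₁ y hy h₂ z hz h => h.elim (h₁ z (hy.trans hz)) (h₂ z hz)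
  | bot_elim A => simp only [I_imp_true]; exact fun x _ h => h.elim
  | ex_intro y t A h =>
    simp only [I_imp_true, M.I_subst h]
    exact fun x hx hA => ⟨_, M.val_mem (fun v => M.D_mono _ _ hx (hρ v)) t, hA⟩
  | ex_elim x y A B hB hy h =>
    simp only [I_imp_true]
    rintro w₁ - h₁ w₂ h₂ ⟨d, hd, hA⟩
    rw [M.I_subst h] at hA
    -- The assignment in `hA` has `d` at both `y` and `x`. The extra value at `y` is harmless
    -- because `y` is `x` or is not free in `A`.
    have hA' : M.I A true w₂ (Function.update ρ x d) := by
      refine (M.I_congr A _ _ _ _ fun v hv => ?_).1 hA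
      by_cases e : v = x
      · subst e; simp [val]
      · rw [Function.update_of_ne e, Function.update_of_ne e, Function.update_of_ne]
        rintro rfl
        exact hy.elim e fun hn => hn hv
    refine (M.I_congr B _ _ _ _ fun v hv => ?_).1
      (M.I_imp_true.1 (h₁ w₂ h₂ d hd) w₂ le_rfl hA')
    rw [Function.update_of_ne (ne_of_mem_of_not_mem hv hB)]
  | all_intro x A B hB =>
    simp only [I_imp_true]
    intro w₁ _ h₁ w₂ h₂ hB' w₃ h₃ d hd
    refine M.I_imp_true.1 (h₁ w₃ (h₂.trans h₃) d hd) w₃ le_rfl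
      ((M.I_congr B _ _ _ _ fun v hv => ?_).1 (M.I_mono _ _ _ h₃ hB'))
    rw [Function.update_of_ne (ne_of_mem_of_not_mem hv hB)]
  | all_elim y t A h =>
    simp only [I_imp_true, M.I_subst h]
    exact fun x hx hA => hA x le_rfl _ (M.val_mem (fun v => M.D_mono _ _ hx (hρ v)) t)
  | tilde_bot A => simp only [I_imp_true]; exact fun _ _ _ => trivial
  | tilde_tilde A => exact ⟨M.I_imp_true.2 fun _ _ => id, M.I_imp_true.2 fun _ _ => id⟩
  | tilde_and A B => exact ⟨M.I_imp_true.2 fun _ _ => id, M.I_imp_true.2 fun _ _ => id⟩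
  | tilde_or A B => exact ⟨M.I_imp_true.2 fun _ _ => id, M.I_imp_true.2 fun _ _ => id⟩
  | tilde_imp A B =>
    exact ⟨M.I_imp_true.2 fun _ _ h => ⟨fun y hy => Or.inl (h.1 y hy), h.2⟩,
      M.I_imp_true.2 fun _ _ h => ⟨fun y hy => (h.1 y hy).elim id False.elim, h.2⟩⟩
  | tilde_all x A => exact ⟨M.I_imp_true.2 fun _ _ => id, M.I_imp_true.2 fun _ _ => id⟩
  | tilde_ex x A => exact ⟨M.I_imp_true.2 fun _ _ => id, M.I_imp_true.2 fun _ _ => id⟩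

end Model

/-- Generalization forces the induction to range over all later worlds and all assignments into
their domains, since `∀` looks at both. -/
theorem Provable.sound {Γ : Set Formula} {A : Formula}
    (h : Provable Γ A) (M : Model.{u, v}) (w : M.W)
    (hw : ∀ B ∈ Γ, ∀ ρ, M.I B true w ρ) :
    ∀ x, w ≤ x → ∀ ρ : ℕ → M.U, (∀ y, ρ y ∈ M.D x) → M.I A true x ρ := by
  induction h with
  | hyp h => exact fun x hx ρ _ => M.I_mono _ _ _ hx (hw _ h ρ)
  | ax h => exact fun x _ ρ hρ => M.I_of_ax h x ρ hρ
  | mp _ _ ihA ihAB =>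
    exact fun x hx ρ hρ => M.I_imp_true.1 (ihAB x hx ρ hρ) x le_rfl (ihA x hx ρ hρ)
  | gen y _ ih =>
    exact fun x hx ρ hρ z hz d hd => ih z (hx.trans hz) _
      (M.update_mem (fun v => M.D_mono _ _ hz (hρ v)) y hd)

theorem Provable.entails {Γ : Set Formula} (hΓ : ∀ B ∈ Γ, B.IsSentence) {A : Formula}
    (h : Provable Γ A) : Entails.{u, v} Γ A := fun M w ρ hρ hw =>
  h.sound M w (fun B hB _ => (M.I_sentence (hΓ B hB) _ _ _ _).1 (hw B hB)) w le_rfl ρ hρ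

/-! ### Derivations -/

open Formula

namespace Provable

variable {Γ Δ : Set Formula} {A B C : Formula}

theorem mono (h : Provable Γ A) (hΓ : Γ ⊆ Δ) : Provable Δ A := by
  induction h with
  | hyp h => exact hyp (hΓ h)
  | ax h => exact ax h
  | mp _ _ ihA ihAB => exact mp ihA ihAB
  | gen x _ ih => exact gen x ih

theorem const_imp (B : Formula) (h : Provable Γ A) : Provable Γ (B.imp A) := mp h (ax (.k A B))

theorem imp_mp (h₁ : Provable Γ (C.imp (A.imp B))) (h₂ : Provable Γ (C.imp A)) :
    Provable Γ (C.imp B) := mp h₂ (mp h₁ (ax (.s C A B)))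

theorem imp_refl (Γ : Set Formula) (A : Formula) : Provable Γ (A.imp A) :=
  imp_mp (ax (.k A (A.imp A))) (ax (.k A A))

/-- The deduction theorem for sentences. -/
theorem deduction (hB : B.IsSentence) (h : Provable (insert B Γ) A) : Provable Γ (B.imp A) := by
  induction h with
  | hyp h =>
    rcases h with rfl | h
    exacts [imp_refl _ _, const_imp B (hyp h)]
  | ax h => exact const_imp B (ax h)
  | mp _ _ ihA ihAB => exact imp_mp ihAB ihA
  -- The axiom `all_intro` applies because a sentence has no free `x`.
  | gen x _ ih => exact mp (gen x ih) (ax (.all_intro x _ _ (by rw [hB]; simp)))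

/-- A derivation uses finitely many premises, and these all occur in one member of the chain. -/
theorem compact {Δ : ℕ → Set Formula} (hΔ : Monotone Δ) (h : Provable (⋃ n, Δ n) A) :
    ∃ n, Provable (Δ n) A := by
  induction h with
  | hyp h => obtain ⟨n, hn⟩ := Set.mem_iUnion.1 h; exact ⟨n, hyp hn⟩
  | ax h => exact ⟨0, ax h⟩
  | mp _ _ ihA ihAB =>
    obtain ⟨n, hn⟩ := ihA
    obtain ⟨m, hm⟩ := ihAB
    exact ⟨max n m, mp (hn.mono (hΔ (le_max_left _ _))) (hm.mono (hΔ (le_max_right _ _)))⟩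
  | gen x _ ih => obtain ⟨n, hn⟩ := ih; exact ⟨n, gen x hn⟩

end Provable

/-! ### Replacing constants in derivations. -/

theorem Ax.mapConst {A : Formula} (h : Ax A) {γ : ℕ → Term}
    (hγ : ∀ c, ∀ v ∈ A.allVars, v ∉ (γ c).vars) : Ax (A.mapConst γ) := by
  cases h with
  | k A B => exact .k _ _
  | s A B C => exact .s _ _ _
  | and_left A B => exact .and_left _ _
  | and_right A B => exact .and_right _ _
  | and_intro A B C => exact .and_intro _ _ _
  | or_left A B => exact .or_left _ _
  | or_right A B => exact .or_right _ _
  | or_elim A B C => exact .or_elim _ _ _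
  | bot_elim A => exact .bot_elim _
  | ex_intro x t A h =>
    have hx : ∀ c, x ∉ (γ c).vars := fun c => hγ c x (by simp [allVars])
    have := Ax.ex_intro x (t.bind γ .var) (A.mapConst γ)
      (h.mapConst hx fun c v hv => hγ c v (by simp [allVars, hv]))
    rwa [← mapConst_subst hx, ← mapConst_ex] at this
  | all_elim x t A h =>
    have hx : ∀ c, x ∉ (γ c).vars := fun c => hγ c x (by simp [allVars])
    have := Ax.all_elim x (t.bind γ .var) (A.mapConst γ)
      (h.mapConst hx fun c v hv => hγ c v (by simp [allVars, hv]))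
    rwa [← mapConst_subst hx, ← mapConst_all] at this
  | ex_elim x y A B hB hy h =>
    have hx : ∀ c, x ∉ (γ c).vars := fun c => hγ c x (by simp [allVars])
    have hy' : ∀ c, y ∉ (γ c).vars := fun c => hγ c y (by simp [allVars])
    have := Ax.ex_elim x y (A.mapConst γ) (B.mapConst γ) (mt (mem_freeVars_mapConst hx) hB)
      (hy.imp_right (mt (mem_freeVars_mapConst hy')))
      (h.mapConst hx fun c v hv => hγ c v (by simp [allVars, hv]))
    have e := mapConst_subst hx (.var y) A
    simp only [Term.bind] at e
    rw [← e, ← mapConst_ex] at this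
    simpa only [Formula.mapConst, Formula.bind, update_var] using this
  | all_intro x A B hB =>
    have hx : ∀ c, x ∉ (γ c).vars := fun c => hγ c x (by simp [allVars])
    have := Ax.all_intro x (A.mapConst γ) (B.mapConst γ) (mt (mem_freeVars_mapConst hx) hB)
    simpa only [Formula.mapConst, Formula.bind, update_var] using this
  | tilde_bot A => exact .tilde_bot _
  | tilde_tilde A => exact .tilde_tilde _
  | tilde_and A B => exact .tilde_and _ _
  | tilde_or A B => exact .tilde_or _ _
  | tilde_imp A B => exact .tilde_imp _ _
  | tilde_all x A =>
    have := Ax.tilde_all x (A.mapConst γ)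
    simpa only [Formula.mapConst, Formula.iff, Formula.bind, update_var] using this
  | tilde_ex x A =>
    have := Ax.tilde_ex x (A.mapConst γ)
    simpa only [Formula.mapConst, Formula.iff, Formula.bind, update_var] using this

namespace Provable

variable {Γ Δ : Set Formula} {A B C : Formula}

/-- Constants may be replaced in a derivation by terms whose variables avoid finitely many
variables. -/
theorem mapConst (h : Provable Γ A) : ∃ N : Finset ℕ, ∀ γ : ℕ → Term,
    (∀ c, ∀ v ∈ N, v ∉ (γ c).vars) → Provable (Formula.mapConst γ '' Γ) (A.mapConst γ) := by
  induction h with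
  | hyp h => exact ⟨∅, fun γ _ => hyp (Set.mem_image_of_mem _ h)⟩
  | @ax A h => exact ⟨A.allVars, fun γ hγ => ax (h.mapConst hγ)⟩
  | mp _ _ ihA ihAB =>
    obtain ⟨N, hN⟩ := ihA
    obtain ⟨N', hN'⟩ := ihAB
    exact ⟨N ∪ N', fun γ hγ => mp (hN γ fun c v hv => hγ c v (Finset.mem_union_left _ hv))
      (hN' γ fun c v hv => hγ c v (Finset.mem_union_right _ hv))⟩
  | gen x _ ih =>
    obtain ⟨N, hN⟩ := ih
    exact ⟨N, fun γ hγ => by rw [mapConst_all]; exact gen x (hN γ hγ)⟩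

/-- Generalization on a fresh constant. -/
theorem all_of_const {x c : ℕ} (hΓ : ∀ B ∈ Γ, c ∉ B.consts) (hA : c ∉ A.consts)
    (h : Provable Γ (A.subst x (.const c))) : Provable Γ (all x A) := by
  obtain ⟨N, hN⟩ := h.mapConst
  -- The constant `c` is traded for a variable `z` that the derivation tolerates and that occurs
  -- nowhere in `A`.
  obtain ⟨z, hz⟩ := Infinite.exists_notMem_finset (N ∪ insert x A.allVars)
  simp only [Finset.mem_union, Finset.mem_insert, not_or] at hz
  obtain ⟨hzN, hzx, hzA⟩ := hz
  set γ : ℕ → Term := fun d => if d = c then .var z else .const d with hγ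
  have hvars : ∀ d v, v ≠ z → v ∉ (γ d).vars := by
    intro d v hv
    by_cases hd : d = c <;> simp [hγ, hd, Term.vars, hv]
  have hself : ∀ B : Formula, c ∉ B.consts → B.mapConst γ = B := fun B hB =>
    mapConst_eq_self fun d hd => by simp [hγ, ne_of_mem_of_not_mem hd hB]
  have h₁ := hN γ fun d v hv => hvars d v (ne_of_mem_of_not_mem hv hzN)
  rw [mapConst_subst fun d => hvars d x (Ne.symm hzx), hself A hA] at h₁
  have h₂ : Provable Γ (A.subst x (.var z)) := by
    have e : Term.bind γ .var (.const c) = .var z := by simp [Term.bind, hγ]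
    rw [e] at h₁
    refine h₁.mono ?_
    rintro _ ⟨B, hB, rfl⟩
    rwa [hself B (hΓ B hB)]
  -- Generalizing over `z` and instantiating by `x` gives `A` itself.
  have h₃ := mp (gen z h₂) (ax (.all_elim z (.var x) _ (freeFor_subst_fresh hzA)))
  rw [subst_subst_fresh hzA] at h₃
  exact gen x h₃

/-- Elimination of an existential quantifier with a fresh constant as witness. -/
theorem ex_imp_of_const {x c : ℕ} (hΓ : ∀ B ∈ Γ, c ∉ B.consts) (hA : c ∉ A.consts)
    (hC : c ∉ C.consts) (hxC : x ∉ C.freeVars) (h : Provable Γ ((A.subst x (.const c)).imp C)) :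
    Provable Γ ((ex x A).imp C) := by
  have h₁ : Provable Γ (all x (A.imp C)) := by
    refine all_of_const hΓ (c := c) (by simp [consts, hA, hC]) ?_
    simpa only [subst, subst_of_notMem hxC] using h
  have h₂ := mp h₁ (ax (.ex_elim x x A C hxC (Or.inl rfl) (freeFor_self x A)))
  rwa [subst_self] at h₂

end Provable

/-! ### Saturated theories -/

/-- The sentences with constants of level at most `k`, the level of a constant `c` being the first
component of the pair coded by `c`. -/
def Lang (k : ℕ) (A : Formula) : Prop := A.IsSentence ∧ ∀ c ∈ A.consts, (Nat.unpair c).1 ≤ k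

section Lang

variable {k : ℕ} {A B : Formula}

theorem Lang.mono {l : ℕ} (h : Lang k A) (hl : k ≤ l) : Lang l A :=
  ⟨h.1, fun c hc => (h.2 c hc).trans hl⟩

theorem lang_bot : Lang k bot := ⟨rfl, by simp [consts]⟩

theorem lang_tilde : Lang k (tilde A) ↔ Lang k A := Iff.rfl

theorem lang_and : Lang k (A.and B) ↔ Lang k A ∧ Lang k B := by
  simp only [Lang, IsSentence, freeVars, consts, Finset.union_eq_empty, Finset.mem_union]
  grind

theorem lang_or : Lang k (A.or B) ↔ Lang k A ∧ Lang k B := lang_and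

theorem lang_imp : Lang k (A.imp B) ↔ Lang k A ∧ Lang k B := lang_and

theorem Lang.subst {x c : ℕ} (h : Lang k (all x A)) (hc : (Nat.unpair c).1 ≤ k) :
    Lang k (A.subst x (.const c)) := by
  refine ⟨Finset.eq_empty_of_forall_notMem fun v hv => ?_, fun d hd => ?_⟩
  · rcases mem_freeVars_subst hv with ⟨h₁, h₂⟩ | h₁
    · have : v ∈ (all x A).freeVars := Finset.mem_erase.2 ⟨h₂, h₁⟩
      rw [h.1] at this
      simp at this
    · simp [Term.vars] at h₁
  · rcases mem_consts_subst hd with h₁ | h₁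
    · exact h.2 d h₁
    · simp only [Term.consts, Finset.mem_singleton] at h₁
      rwa [h₁]

end Lang

/-- Consistent prime theories with witnesses in the language of level `k`. -/
structure Saturated (k : ℕ) (T : Set Formula) : Prop where
  lang : ∀ A ∈ T, Lang k A
  closed : ∀ A, Lang k A → Provable T A → A ∈ T
  consistent : bot ∉ T
  prime : ∀ A B, A.or B ∈ T → A ∈ T ∨ B ∈ T
  witness : ∀ x A, ex x A ∈ T → ∃ c, (Nat.unpair c).1 ≤ k ∧ A.subst x (.const c) ∈ T

/-- The sets that occur in the construction of a saturated theory that does not prove `A`. -/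
structure Stage (k : ℕ) (A : Formula) (Δ : Set Formula) : Prop where
  lang : ∀ B ∈ Δ, Lang (k + 1) B
  notProvable : ¬ Provable Δ A
  -- Only finitely many constants above level `k` are in use, so level `k + 1` always has a fresh
  -- one.
  finite : ∃ F : Finset ℕ, ∀ B ∈ Δ, ∀ c ∈ B.consts, (Nat.unpair c).1 ≤ k ∨ c ∈ F

theorem Stage.insert {k : ℕ} {A B : Formula} {Δ : Set Formula} (h : Stage k A Δ)
    (hB : Lang (k + 1) B) (hA : ¬ Provable (insert B Δ) A) : Stage k A (insert B Δ) := by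
  refine ⟨?_, hA, ?_⟩
  · rintro C (rfl | hC)
    exacts [hB, h.lang C hC]
  · obtain ⟨F, hF⟩ := h.finite
    refine ⟨F ∪ B.consts, ?_⟩
    rintro C (rfl | hC) c hc
    · exact Or.inr (Finset.mem_union_right _ hc)
    · exact (hF C hC c hc).imp_right (Finset.mem_union_left _)

theorem exists_fresh (k : ℕ) (F : Finset ℕ) : ∃ c, (Nat.unpair c).1 = k ∧ c ∉ F := by
  have : Function.Injective (Nat.pair k) := fun a b h => (Nat.pair_eq_pair.1 h).2
  obtain ⟨_, ⟨j, rfl⟩, hj⟩ := (Set.infinite_range_of_injective this).exists_notMem_finset F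
  exact ⟨_, by simp, hj⟩

/-- One Lindenbaum step: `B` is added if `A` stays unprovable, and an existential `B` brings a
witness along. -/
theorem Stage.next {k : ℕ} {A : Formula} (hA : Lang (k + 1) A) {Δ : Set Formula}
    (h : Stage k A Δ) (B : Formula) :
    ∃ Δ', Δ ⊆ Δ' ∧ Stage k A Δ' ∧ (Lang (k + 1) B → ¬ Provable (Insert.insert B Δ) A →
      B ∈ Δ' ∧ ∀ x C, B = ex x C →
        ∃ c, (Nat.unpair c).1 ≤ k + 1 ∧ C.subst x (.const c) ∈ Δ') := by
  by_cases hB : Lang (k + 1) B ∧ ¬ Provable (Insert.insert B Δ) A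
  swap
  · exact ⟨Δ, subset_rfl, h, fun h₁ h₂ => absurd ⟨h₁, h₂⟩ hB⟩
  obtain ⟨hB, hBA⟩ := hB
  have hs := h.insert hB hBA
  by_cases hex : ∃ x C, B = ex x C
  swap
  · exact ⟨_, Set.subset_insert _ _, hs, fun _ _ => ⟨Set.mem_insert _ _,
      fun x C e => absurd ⟨x, C, e⟩ hex⟩⟩
  obtain ⟨x, C, rfl⟩ := hex
  obtain ⟨F, hF⟩ := hs.finite
  obtain ⟨c, hck, hc⟩ := exists_fresh (k + 1) (F ∪ A.consts)
  simp only [Finset.mem_union, not_or] at hc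
  have hΔ : ∀ D ∈ Insert.insert (ex x C) Δ, c ∉ D.consts := fun D hD hcD =>
    (hF D hD c hcD).elim (by omega) hc.1
  have hCl : Lang (k + 1) (C.subst x (.const c)) := Lang.subst (x := x) hB hck.le
  refine ⟨_, (Set.subset_insert _ _).trans (Set.subset_insert (C.subst x (.const c)) _),
    hs.insert hCl fun hp => hBA ?_, fun _ _ => ⟨Or.inr (Or.inl rfl), ?_⟩⟩
  -- If the witness made `A` provable, existential elimination on the fresh `c` would make `A`
  -- provable from the existential alone.
  · exact .mp (.hyp (Set.mem_insert _ _)) (Provable.ex_imp_of_const hΔ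
      (hΔ (ex x C) (Set.mem_insert _ _)) hc.2 (by rw [hA.1]; simp) (hp.deduction hCl.1))
  · rintro y D e
    obtain ⟨rfl, rfl⟩ := Formula.ex.inj e
    exact ⟨c, hck.le, Set.mem_insert _ _⟩

/-- An unprovable sentence is omitted by a saturated theory of the next level. -/
theorem exists_saturated {k : ℕ} {Γ : Set Formula} (hΓ : ∀ B ∈ Γ, Lang k B) {A : Formula}
    (hA : Lang k A) (h : ¬ Provable Γ A) : ∃ T, Γ ⊆ T ∧ Saturated (k + 1) T ∧ A ∉ T := by
  obtain ⟨e, he⟩ := exists_surjective_nat Formula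
  have hA' := hA.mono k.le_succ
  choose f hf₁ hf₂ hf₃ using fun (Δ : {Δ // Stage k A Δ}) B => Δ.2.next hA' B
  let s : ℕ → {Δ // Stage k A Δ} := fun n => Nat.rec
    ⟨Γ, fun B hB => (hΓ B hB).mono k.le_succ, h, ∅, fun B hB c hc => Or.inl ((hΓ B hB).2 c hc)⟩
    (fun n Δ => ⟨f Δ (e n), hf₂ Δ (e n)⟩) n
  have hmono : Monotone fun n => (s n).1 := monotone_nat_of_le_succ fun n => hf₁ (s n) (e n)
  have hsub : ∀ n, (s n).1 ⊆ ⋃ n, (s n).1 := fun n => Set.subset_iUnion (fun n => (s n).1) n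
  set T : Set Formula := ⋃ n, (s n).1
  have hT : ¬ Provable T A := fun hp => by
    obtain ⟨n, hn⟩ := Provable.compact hmono hp
    exact (s n).2.notProvable hn
  have hlang : ∀ B ∈ T, Lang (k + 1) B := fun B hB => by
    obtain ⟨n, hn⟩ := Set.mem_iUnion.1 hB
    exact (s n).2.lang B hn
  -- Maximality: `B` is considered at some stage, and that stage with `B` proves no more than `T`
  -- with `B`.
  have key : ∀ B, Lang (k + 1) B → ¬ Provable (insert B T) A → B ∈ T ∧ ∀ x C, B = ex x C →
      ∃ c, (Nat.unpair c).1 ≤ k + 1 ∧ C.subst x (.const c) ∈ T := by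
    intro B hB hBA
    obtain ⟨n, rfl⟩ := he B
    have := hf₃ (s n) (e n) hB fun hp => hBA (hp.mono (Set.insert_subset_insert (hsub n)))
    refine ⟨hsub (n + 1) this.1, fun x C hC => ?_⟩
    obtain ⟨c, hc, hm⟩ := this.2 x C hC
    exact ⟨c, hc, hsub (n + 1) hm⟩
  have hcut : ∀ B, Lang (k + 1) B → Provable T B → ¬ Provable (insert B T) A :=
    fun B hB hp hBA => hT (.mp hp (hBA.deduction hB.1))
  refine ⟨T, hsub 0, ⟨hlang, fun B hB hp => (key B hB (hcut B hB hp)).1, fun hb => ?_, ?_, ?_⟩,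
    fun hm => hT (.hyp hm)⟩
  · exact hT (.mp (.hyp hb) (.ax (.bot_elim A)))
  · intro B C hBC
    have hl := lang_or.1 (hlang _ hBC)
    by_contra! hn
    -- A disjunct outside `T` must prove `A` over `T`; if both do, the disjunction does.
    have hB := not_not.1 (mt (fun hp => (key B hl.1 hp).1) hn.1)
    have hC := not_not.1 (mt (fun hp => (key C hl.2 hp).1) hn.2)
    exact hT (.mp (.hyp hBC) (.mp (hC.deduction hl.2.1) (.mp (hB.deduction hl.1.1)
      (.ax (.or_elim B C A)))))
  · intro x C hm
    exact (key _ (hlang _ hm) (hcut _ (hlang _ hm) (.hyp hm))).2 x C rfl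

/-! ### Membership in saturated theories. -/

namespace Saturated

variable {k : ℕ} {T : Set Formula} (h : Saturated k T) {A B : Formula}
include h

theorem mem_of_imp (hB : Lang k B) (hA : A ∈ T) (hAB : Provable T (A.imp B)) : B ∈ T :=
  h.closed B hB (.mp (.hyp hA) hAB)

theorem mem_congr (hAB : Ax (A.iff B)) (hl : Lang k A ↔ Lang k B) : A ∈ T ↔ B ∈ T :=
  ⟨fun hA => h.mem_of_imp (hl.1 (h.lang A hA)) hA (.mp (.ax hAB) (.ax (.and_left _ _))),
    fun hB => h.mem_of_imp (hl.2 (h.lang B hB)) hB (.mp (.ax hAB) (.ax (.and_right _ _)))⟩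

theorem and_mem : A.and B ∈ T ↔ A ∈ T ∧ B ∈ T := by
  refine ⟨fun hm => ?_, fun ⟨hA, hB⟩ => ?_⟩
  · have hl := lang_and.1 (h.lang _ hm)
    exact ⟨h.mem_of_imp hl.1 hm (.ax (.and_left A B)),
      h.mem_of_imp hl.2 hm (.ax (.and_right A B))⟩
  · exact h.mem_of_imp (lang_and.2 ⟨h.lang A hA, h.lang B hB⟩) hA
      (.mp (.const_imp A (.hyp hB)) (.mp (.imp_refl T A) (.ax (.and_intro A B A))))

theorem or_mem (hA : Lang k A) (hB : Lang k B) : A.or B ∈ T ↔ A ∈ T ∨ B ∈ T := by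
  refine ⟨h.prime A B, ?_⟩
  rintro (hm | hm)
  exacts [h.mem_of_imp (lang_or.2 ⟨hA, hB⟩) hm (.ax (.or_left A B)),
    h.mem_of_imp (lang_or.2 ⟨hA, hB⟩) hm (.ax (.or_right A B))]

theorem ex_mem {x : ℕ} (hA : Lang k (ex x A)) :
    ex x A ∈ T ↔ ∃ c, (Nat.unpair c).1 ≤ k ∧ A.subst x (.const c) ∈ T :=
  ⟨h.witness x A, fun ⟨c, _, hm⟩ =>
    h.mem_of_imp hA hm (.ax (.ex_intro x (.const c) A (freeFor_const x c A)))⟩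

theorem tilde_tilde_mem : tilde (tilde A) ∈ T ↔ A ∈ T :=
  h.mem_congr (.tilde_tilde A) Iff.rfl

theorem tilde_and_mem (hA : Lang k A) (hB : Lang k B) :
    tilde (A.and B) ∈ T ↔ tilde A ∈ T ∨ tilde B ∈ T :=
  (h.mem_congr (.tilde_and A B) Iff.rfl).trans (h.or_mem (lang_tilde.2 hA) (lang_tilde.2 hB))

theorem tilde_or_mem : tilde (A.or B) ∈ T ↔ tilde A ∈ T ∧ tilde B ∈ T :=
  (h.mem_congr (.tilde_or A B) Iff.rfl).trans h.and_mem

theorem tilde_imp_mem (hA : Lang k A) (hB : Lang k B) :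
    tilde (A.imp B) ∈ T ↔ (tilde A).neg ∈ T ∧ tilde B ∈ T :=
  (h.mem_congr (.tilde_imp A B) (iff_of_true (lang_tilde.2 (lang_imp.2 ⟨hA, hB⟩)) (lang_and.2
    ⟨lang_imp.2 ⟨lang_tilde.2 hA, lang_bot⟩, lang_tilde.2 hB⟩))).trans h.and_mem

theorem tilde_all_mem {x : ℕ} : tilde (all x A) ∈ T ↔ ex x (tilde A) ∈ T :=
  h.mem_congr (.tilde_all x A) Iff.rfl

theorem tilde_ex_mem {x : ℕ} : tilde (ex x A) ∈ T ↔ all x (tilde A) ∈ T :=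
  h.mem_congr (.tilde_ex x A) Iff.rfl

end Saturated

/-- The worlds of the canonical model, ordered by inclusion of levels and theories. -/
abbrev World : Type := {w : ℕ × Set Formula // Saturated w.1 w.2}

namespace World

variable (w : World) {A B : Formula}

/-- If `A → B` is missing, the deduction theorem shows that adding `A` does not prove `B`, and a
saturated extension of the next level separates them. -/
theorem imp_mem (hA : Lang w.1.1 A) (hB : Lang w.1.1 B) :
    A.imp B ∈ w.1.2 ↔ ∀ x : World, w ≤ x → A ∈ x.1.2 → B ∈ x.1.2 := by
  refine ⟨fun hm x hx hAx => x.2.mem_of_imp (hB.mono hx.1) hAx (.hyp (hx.2 hm)), fun hm => ?_⟩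
  by_contra hn
  have hp : ¬ Provable (insert A w.1.2) B := fun hp =>
    hn (w.2.closed _ (lang_imp.2 ⟨hA, hB⟩) (hp.deduction hA.1))
  obtain ⟨T, hT, hs, hBT⟩ := exists_saturated (k := w.1.1)
    (by rintro C (rfl | hC); exacts [hA, w.2.lang C hC]) hB hp
  exact hBT (hm ⟨(w.1.1 + 1, T), hs⟩ ⟨Nat.le_succ _, (Set.subset_insert _ _).trans hT⟩
    (hT (Set.mem_insert _ _)))

theorem all_mem {y : ℕ} (hA : Lang w.1.1 (all y A)) :
    all y A ∈ w.1.2 ↔ ∀ x : World, w ≤ x → ∀ c, (Nat.unpair c).1 ≤ x.1.1 →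
      A.subst y (.const c) ∈ x.1.2 := by
  refine ⟨fun hm x hx c hc => x.2.mem_of_imp ((hA.mono hx.1).subst hc) (hx.2 hm)
    (.ax (.all_elim y (.const c) A (freeFor_const y c A))), fun hm => ?_⟩
  by_contra hn
  -- A constant of the next level is fresh for the theory, so its instance is unprovable when the
  -- universal sentence is missing.
  obtain ⟨c, hc, -⟩ := exists_fresh (w.1.1 + 1) ∅
  have hfresh : ∀ B, Lang w.1.1 B → c ∉ B.consts := fun B hB hcB => by
    have := hB.2 c hcB
    omega
  have hp : ¬ Provable w.1.2 (A.subst y (.const c)) := fun hp =>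
    hn (w.2.closed _ hA (hp.all_of_const (fun B hB => hfresh B (w.2.lang B hB)) (hfresh _ hA :)))
  -- The instance already lies one level up, so the saturated extension lies two levels up.
  obtain ⟨T, hT, hs, hAT⟩ := exists_saturated (k := w.1.1 + 1)
    (fun B hB => (w.2.lang B hB).mono (Nat.le_succ _))
    ((hA.mono (Nat.le_succ _)).subst hc.le) hp
  exact hAT (hm ⟨(w.1.1 + 2, T), hs⟩ ⟨Nat.le_add_right _ _, hT⟩ c (by
    show _ ≤ w.1.1 + 2
    omega))

end World

/-! ### The canonical model -/

/-- `A` or `∼A`. -/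
def signed : Bool → Formula → Formula
  | true, A => A
  | false, A => tilde A

theorem lang_signed {k : ℕ} {b : Bool} {A : Formula} : Lang k (signed b A) ↔ Lang k A := by
  cases b <;> exact Iff.rfl

/-- The canonical model. The constants of level `0` are the constants of the language, those of
higher levels are new elements. -/
def canonicalModel (w₀ : World) : Model.{u, v} where
  W := ULift.{u} World
  order := inferInstance
  nonempty := ⟨⟨w₀⟩⟩
  U := ULift.{v} ℕ
  con := ⟨fun c => ⟨Nat.pair 0 c⟩, fun a b h =>
    (Nat.pair_eq_pair.1 (congrArg ULift.down h)).2⟩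
  D w := {d | (Nat.unpair d.down).1 ≤ w.down.1.1}
  con_mem w c := by
    show (Nat.unpair (Nat.pair 0 c)).1 ≤ _
    simp
  D_mono w x h d hd := le_trans hd h.1
  V b w n i := {d | signed b (atom n i fun k => .const (d k).down) ∈ w.down.1.2}
  V_dom b w n i d hd k := by
    refine (lang_signed.1 (w.down.2.lang _ hd)).2 _ ?_
    exact Finset.mem_biUnion.2 ⟨k, Finset.mem_univ _, by simp [Term.consts]⟩
  V_mono b w x n i h d hd := h.2 hd

/-- The constant that names the denotation of the constant `c` in the canonical model. -/
def levelZero (c : ℕ) : Term := .const (Nat.pair 0 c)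

/-- The instance of `A` under an assignment in the canonical model. -/
def instantiate (ρ : ℕ → ULift.{v} ℕ) (A : Formula) : Formula :=
  A.bind levelZero fun x => .const (ρ x).down

theorem lang_mapConst_levelZero {A : Formula} (hA : A.IsSentence) :
    Lang 0 (A.mapConst levelZero) := by
  refine ⟨Finset.eq_empty_of_forall_notMem fun v hv => ?_, fun d hd => ?_⟩
  · have := mem_freeVars_mapConst (γ := levelZero) (by simp [levelZero, Term.vars]) hv
    rw [hA] at this
    simp at this
  · refine mem_consts_bind (P := fun d => (Nat.unpair d).1 ≤ 0) ?_ A _ ?_ d hd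
    · simp [levelZero, Term.consts]
    · simp [Term.consts]

theorem lang_instantiate {k : ℕ} {ρ : ℕ → ULift.{v} ℕ}
    (hρ : ∀ x, (Nat.unpair (ρ x).down).1 ≤ k) (A : Formula) : Lang k (instantiate ρ A) := by
  refine ⟨Finset.eq_empty_of_forall_notMem fun v hv => ?_, fun d hd => ?_⟩
  · have := mem_freeVars_bind (γ := levelZero) (by simp [levelZero, Term.vars]) A _
      (by simp [Term.vars]) hv
    simp at this
  · refine mem_consts_bind (P := fun d => (Nat.unpair d).1 ≤ k) ?_ A _ ?_ d hd
    · simp [levelZero, Term.consts]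
    · simpa [Term.consts] using hρ

theorem subst_bind_update (ρ : ℕ → ULift.{v} ℕ) (y : ℕ) (d : ULift.{v} ℕ) (A : Formula) :
    (A.bind levelZero (Function.update (fun x => .const (ρ x).down) y (.var y))).subst y
      (.const d.down) = instantiate (Function.update ρ y d) A := by
  rw [subst_bind (γ := levelZero) fun c => ⟨_, rfl⟩]
  · unfold instantiate
    congr 1
    funext v
    by_cases e : v = y
    · subst e; simp [Term.subst]
    · simp [Function.update_of_ne e, Term.subst]
  · intro v
    by_cases e : v = y
    · subst e; simp
    · simp [Function.update_of_ne e]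

/-- Both signs go through one induction because `∼` exchanges them. The assignment must take values
in the domain of `w`, since otherwise the instance is not in the language of `w`. -/
theorem truth_lemma (w₀ : World) (A : Formula) : ∀ (b : Bool) (w : World) (ρ : ℕ → ULift.{v} ℕ),
    (∀ x, (Nat.unpair (ρ x).down).1 ≤ w.1.1) →
    ((canonicalModel.{u, v} w₀).I A b ⟨w⟩ ρ ↔ signed b (instantiate ρ A) ∈ w.1.2) := by
  have step : ∀ A : Formula, (∀ (b : Bool) (w : World) (ρ : ℕ → ULift.{v} ℕ),
      (∀ x, (Nat.unpair (ρ x).down).1 ≤ w.1.1) →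
      ((canonicalModel.{u, v} w₀).I A b ⟨w⟩ ρ ↔ signed b (instantiate ρ A) ∈ w.1.2)) →
      ∀ (b : Bool) (w : World) (ρ : ℕ → ULift.{v} ℕ),
      (∀ x, (Nat.unpair (ρ x).down).1 ≤ w.1.1) → ∀ (y : ℕ) (d : ULift.{v} ℕ),
      (Nat.unpair d.down).1 ≤ w.1.1 →
      ((canonicalModel.{u, v} w₀).I A b ⟨w⟩ (Function.update ρ y d) ↔ signed b ((A.bind levelZero
        (Function.update (fun x => .const (ρ x).down) y (.var y))).subst y (.const d.down)) ∈
          w.1.2) := by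
    intro A ih b w ρ hρ y d hd
    rw [subst_bind_update]
    exact ih b w _ (Function.forall_update_iff ρ (p := fun _ u => (Nat.unpair u.down).1 ≤ w.1.1)
      |>.2 ⟨hd, fun x _ => hρ x⟩)
  induction A with
  | atom n i t =>
    intro b w ρ _
    have : ∀ k, (t k).bind levelZero (fun x => .const (ρ x).down) =
        .const ((canonicalModel.{u, v} w₀).val ρ (t k)).down := by
      intro k
      cases t k <;> rfl
    simp only [instantiate, Formula.bind, this]
    rfl
  | bot =>
    intro b w ρ _
    cases b
    · exact iff_of_true trivial (w.2.closed _ lang_bot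
        (.mp (.imp_refl _ bot) (.ax (.tilde_bot _))))
    · exact iff_of_false id w.2.consistent
  | tilde A ih =>
    intro b w ρ hρ
    cases b
    exacts [(ih true w ρ hρ).trans w.2.tilde_tilde_mem.symm, ih false w ρ hρ]
  | and A B ihA ihB =>
    intro b w ρ hρ
    cases b
    exacts [(or_congr (ihA false w ρ hρ) (ihB false w ρ hρ)).trans
        (w.2.tilde_and_mem (lang_instantiate hρ A) (lang_instantiate hρ B)).symm,
      (and_congr (ihA true w ρ hρ) (ihB true w ρ hρ)).trans w.2.and_mem.symm]
  | or A B ihA ihB =>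
    intro b w ρ hρ
    cases b
    exacts [(and_congr (ihA false w ρ hρ) (ihB false w ρ hρ)).trans w.2.tilde_or_mem.symm,
      (or_congr (ihA true w ρ hρ) (ihB true w ρ hρ)).trans
        (w.2.or_mem (lang_instantiate hρ A) (lang_instantiate hρ B)).symm]
  | imp A B ihA ihB =>
    intro b w ρ hρ
    have hA := lang_instantiate hρ A
    have hB := lang_instantiate hρ B
    have hρ' : ∀ x : World, w ≤ x → ∀ v, (Nat.unpair (ρ v).down).1 ≤ x.1.1 :=
      fun x hx v => (hρ v).trans hx.1
    cases b
    -- The requirement that `A` be false at no later world is the truth of `¬∼A`, whose consequent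
    -- `⊥` belongs to no world.
    · refine Iff.trans (and_congr ?_ (ihB false w ρ hρ)) (w.2.tilde_imp_mem hA hB).symm
      refine Iff.trans ?_ (w.imp_mem (lang_tilde.2 hA) lang_bot).symm
      exact ⟨fun h x hx hm => absurd ((ihA false x ρ (hρ' x hx)).2 hm) (h ⟨x⟩ hx),
        fun h x hx hm => x.down.2.consistent
          (h x.down hx ((ihA false x.down ρ (hρ' x.down hx)).1 hm))⟩
    · refine (canonicalModel.{u, v} w₀).I_imp_true.trans
        (Iff.trans ?_ (w.imp_mem hA hB).symm)
      exact ⟨fun h x hx hm => (ihB true x ρ (hρ' x hx)).1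
          (h ⟨x⟩ hx ((ihA true x ρ (hρ' x hx)).2 hm)),
        fun h x hx hm => (ihB true x.down ρ (hρ' x.down hx)).2
          (h x.down hx ((ihA true x.down ρ (hρ' x.down hx)).1 hm))⟩
  | all y A ih =>
    intro b w ρ hρ
    have hl := lang_instantiate hρ (all y A)
    have hA := step A ih b
    cases b
    · refine Iff.trans ?_ (w.2.tilde_all_mem.trans (w.2.ex_mem hl)).symm
      exact ⟨fun ⟨d, hd, hm⟩ => ⟨d.down, hd, (hA w ρ hρ y d hd).1 hm⟩,
        fun ⟨c, hc, hm⟩ => ⟨⟨c⟩, hc, (hA w ρ hρ y ⟨c⟩ hc).2 hm⟩⟩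
    · refine Iff.trans ?_ (w.all_mem hl).symm
      exact ⟨fun h x hx c hc =>
          (hA x ρ (fun v => (hρ v).trans hx.1) y ⟨c⟩ hc).1 (h ⟨x⟩ hx ⟨c⟩ hc),
        fun h x hx d hd =>
          (hA x.down ρ (fun v => (hρ v).trans hx.1) y d hd).2 (h x.down hx d.down hd)⟩
  | ex y A ih =>
    intro b w ρ hρ
    have hl := lang_instantiate hρ (ex y A)
    have hA := step A ih b
    cases b
    · refine Iff.trans ?_ (w.2.tilde_ex_mem.trans (w.all_mem hl)).symm
      exact ⟨fun h x hx c hc =>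
          (hA x ρ (fun v => (hρ v).trans hx.1) y ⟨c⟩ hc).1 (h ⟨x⟩ hx ⟨c⟩ hc),
        fun h x hx d hd =>
          (hA x.down ρ (fun v => (hρ v).trans hx.1) y d hd).2 (h x.down hx d.down hd)⟩
    · refine Iff.trans ?_ (w.2.ex_mem hl).symm
      exact ⟨fun ⟨d, hd, hm⟩ => ⟨d.down, hd, (hA w ρ hρ y d hd).1 hm⟩,
        fun ⟨c, hc, hm⟩ => ⟨⟨c⟩, hc, (hA w ρ hρ y ⟨c⟩ hc).2 hm⟩⟩

/-! ### Completeness. -/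

/-- Forgetting levels is a left inverse of the renaming. It introduces no variables, so it may be
applied to the whole derivation. -/
theorem provable_of_mapConst_levelZero {Γ : Set Formula} {A : Formula}
    (h : Provable (Formula.mapConst levelZero '' Γ) (A.mapConst levelZero)) : Provable Γ A := by
  obtain ⟨N, hN⟩ := h.mapConst
  have hinv : ∀ B : Formula,
      (B.mapConst levelZero).mapConst (fun c => .const (Nat.unpair c).2) = B := by
    intro B
    refine (mapConst_mapConst _ (Nat.pair 0) B).trans (mapConst_eq_self fun c _ => by simp)
  have := hN (fun c => .const (Nat.unpair c).2) (by simp [Term.vars])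
  rwa [hinv, Set.image_image, Set.image_congr fun B _ => hinv B, Set.image_id'] at this

theorem Entails.provable {Γ : Set Formula} (hΓ : ∀ B ∈ Γ, B.IsSentence) {A : Formula}
    (hA : A.IsSentence) (h : Entails.{u, v} Γ A) : Provable Γ A := by
  by_contra hn
  obtain ⟨T, hT, hs, hAT⟩ := exists_saturated (k := 0)
    (by rintro _ ⟨B, hB, rfl⟩; exact lang_mapConst_levelZero (hΓ B hB))
    (lang_mapConst_levelZero hA) (mt provable_of_mapConst_levelZero hn)
  let w : World := ⟨(1, T), hs⟩
  -- Any assignment into the domain would do; the constant `0` has level `0`.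
  let ρ : ℕ → ULift.{v} ℕ := fun _ => ⟨0⟩
  have hρ : ∀ x, (Nat.unpair (ρ x).down).1 ≤ w.1.1 := fun x => by simp [ρ]
  have key : ∀ B : Formula, B.IsSentence →
      ((canonicalModel.{u, v} w).I B true ⟨w⟩ ρ ↔ B.mapConst levelZero ∈ T) := by
    intro B hB
    rw [truth_lemma w B true w ρ hρ]
    have : instantiate ρ B = B.mapConst levelZero := bind_congr (by rw [hB]; simp)
    rw [signed, this]
  exact hAT ((key A hA).1 (h (canonicalModel w) ⟨w⟩ ρ hρ fun B hB =>
    (key B (hΓ B hB)).2 (hT (Set.mem_image_of_mem _ hB))))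

end QBDi

theorem mainTheorem4 (Γ : Set QBDi.Formula) (A : QBDi.Formula)
    (hΓ : ∀ B ∈ Γ, B.IsSentence) (hA : A.IsSentence) :
    QBDi.Provable Γ A ↔ QBDi.Entails.{u, v} Γ A :=
  ⟨fun h => h.entails hΓ, fun h => h.provable hΓ hA⟩
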